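/- For a real number $q>1$, an expansion of $x$ in base $q$ is a sequence $(c_i)_{i\ge 1}$ of integers $0\le c_i<q$ with $x=\sum_{i\ge1}c_iq^{-i}$. Put $m=\lceil q\rceil-1$ and $J_q=[0,m/(q-1)]$. Let $\mathcal U_q$ be the set of $x\in J_q$ having exactly one expansion in base $q$, let $\mathcal U_q'$ be the set of expansions in base $q$ of the elements of $\mathcal U_q$, and let $\mathcal U$ be the set of real numbers $q>1$ such that $1$ has exactly one expansion in base $q$. For $x\in J_q\setminus\{0\}$ the quasi-greedy expansion $(a_i(x))$ of $x$ in base $q$ is defined recursively: $a_n(x)$ is the largest integer smaller than $q$ such that $\sum_{i=1}^n a_i(x)q^{-i}<x$; moreover $(a_i(0)):=0^\infty$. Write $\alpha_i(q):=a_i(1)$, $\overline{c_1c_2\ldots}:=(m-c_1)(m-c_2)\ldots$, and compare sequences lexicographically. Let $$\mathcal V_q=\{x\in J_q:\ \overline{a_{n+1}(x)a_{n+2}(x)\ldots}\le\alpha_1(q)\alpha_2(q)\ldots\ \text{ whenever } a_n(x)>0\},\qquad \mathcal V_q'=\{(a_i(x)):x\in\mathcal V_q\}.$$ For non-integer $q>1$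 let $\mathcal G_q'=\bigcap\,\mathcal U_r'$, where the intersection runs over all real $r>q$ with $\lceil r\rceil=\lceil q\rceil$. Then for every non-integer $q>1$ one has $\mathcal G_q'=\mathcal V_q'$, and the set $\mathcal G_q'\setminus\mathcal U_q'$ is countable (whether or not $q\in\mathcal U$). Consequently it is not true that, for all non-integer $q>1$, $q\in\mathcal U$ if and only if $\mathcal G_q'\setminus\mathcal U_q'$ is uncountable. -/

import Mathlib

/-
Sequences `c_1 c_2 c_3 ...` of nonnegative integers are functions `c : ℕ → ℕ`;
the term `c_i` with `i ≥ 1` is `c (i - 1)`, so that `c i` carries the weight `q ^ (i + 1)`.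
-/
namespace UniqueExpansions

/-- `c` is an expansion of `x` in base `q`: all digits are integers `0 ≤ c_i < q` and
`x = ∑ c_i / q ^ i`. -/
def IsExpansion (q x : ℝ) (c : ℕ → ℕ) : Prop :=
  (∀ i, (c i : ℝ) < q) ∧ HasSum (fun i => (c i : ℝ) / q ^ (i + 1)) x

/-- The interval `J_q = [0, (⌈q⌉ - 1) / (q - 1)]`. -/
def interval (q : ℝ) : Set ℝ :=
  Set.Icc 0 (((⌈q⌉ : ℝ) - 1) / (q - 1))

/-- The set `𝒰_q` of the numbers in `J_q` with a unique expansion in base `q`. -/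
def uniqueSet (q : ℝ) : Set ℝ :=
  {x | x ∈ interval q ∧ ∃! c : ℕ → ℕ, IsExpansion q x c}

/-- The set `𝒰_q'` of the univoque sequences in base `q`: sequences of digits whose value
belongs to `𝒰_q`. -/
def univoqueSeqs (q : ℝ) : Set (ℕ → ℕ) :=
  {c | ∃ x ∈ uniqueSet q, IsExpansion q x c}

/-- The set `𝒰` of univoque numbers. -/
def univoqueNumbers : Set ℝ :=
  {q | 1 < q ∧ ∃! c : ℕ → ℕ, IsExpansion q 1 c}

/-- The quasi-greedy expansion of `x` in base `q`: when the first `n` digits are chosen, the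
next one is the largest integer `d < q` for which the partial sum stays strictly below `x`. -/
noncomputable def quasiGreedy (q x : ℝ) (n : ℕ) : ℕ :=
  sSup {d : ℕ | (d : ℝ) < q ∧
    (∑ i : Fin n, (quasiGreedy q x i : ℝ) / q ^ ((i : ℕ) + 1)) + (d : ℝ) / q ^ (n + 1) < x}
termination_by n
decreasing_by exact i.2

/-- For `x > 0` the supremum in the definition of `quasiGreedy` is a maximum. -/
theorem quasiGreedy_isGreatest {q x : ℝ} (hq : 1 < q) (hx : 0 < x) (n : ℕ) :
    IsGreatest {d : ℕ | (d : ℝ) < q ∧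
      (∑ i ∈ Finset.range n, (quasiGreedy q x i : ℝ) / q ^ (i + 1)) + (d : ℝ) / q ^ (n + 1) < x}
      (quasiGreedy q x n) := by
  have key : ∀ n, (∑ i ∈ Finset.range n, (quasiGreedy q x i : ℝ) / q ^ (i + 1)) < x →
      IsGreatest {d : ℕ | (d : ℝ) < q ∧
        (∑ i ∈ Finset.range n, (quasiGreedy q x i : ℝ) / q ^ (i + 1)) +
          (d : ℝ) / q ^ (n + 1) < x} (quasiGreedy q x n) := by
    intro n h
    have e : quasiGreedy q x n = sSup {d : ℕ | (d : ℝ) < q ∧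
        (∑ i ∈ Finset.range n, (quasiGreedy q x i : ℝ) / q ^ (i + 1)) +
          (d : ℝ) / q ^ (n + 1) < x} := by
      rw [quasiGreedy]
      simp only [Finset.sum_range]
    have hb : BddAbove {d : ℕ | (d : ℝ) < q ∧
        (∑ i ∈ Finset.range n, (quasiGreedy q x i : ℝ) / q ^ (i + 1)) +
          (d : ℝ) / q ^ (n + 1) < x} := by
      refine ⟨⌈q⌉₊, fun d hd => ?_⟩
      have h1 : (d : ℝ) ≤ (⌈q⌉₊ : ℝ) := hd.1.le.trans (Nat.le_ceil q)
      exact_mod_cast h1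
    rw [e]
    refine ⟨Nat.sSup_mem ⟨0, ?_⟩ hb, fun d hd => le_csSup hb hd⟩
    refine ⟨?_, ?_⟩
    · simpa using zero_lt_one.trans hq
    · simpa using h
  have part : ∀ n, (∑ i ∈ Finset.range n, (quasiGreedy q x i : ℝ) / q ^ (i + 1)) < x := by
    intro n
    induction n with
    | zero => simpa using hx
    | succ k ih =>
      rw [Finset.sum_range_succ]
      exact (key k ih).1.2
  exact key n (part n)

/-- The convention that the quasi-greedy expansion of `0` is `0 0 0 ...`. -/
theorem quasiGreedy_zero {q : ℝ} (hq : 1 < q) (n : ℕ) : quasiGreedy q 0 n = 0 := by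
  have hq0 : 0 < q := zero_lt_one.trans hq
  have e : {d : ℕ | (d : ℝ) < q ∧
      (∑ i : Fin n, (quasiGreedy q 0 i : ℝ) / q ^ ((i : ℕ) + 1)) +
        (d : ℝ) / q ^ (n + 1) < 0} = ∅ := by
    refine Set.eq_empty_of_forall_notMem fun d hd => ?_
    have h : 0 ≤ (∑ i : Fin n, (quasiGreedy q 0 i : ℝ) / q ^ ((i : ℕ) + 1)) +
        (d : ℝ) / q ^ (n + 1) := by positivity
    exact absurd hd.2 (not_lt.mpr h)
  rw [quasiGreedy, e]
  simp

/-- The sequence `(α_i(q))`, the quasi-greedy expansion of `1` in base `q`. -/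
noncomputable def alpha (q : ℝ) : ℕ → ℕ := quasiGreedy q 1

/-- The sequence `c_{n+1} c_{n+2} ...` left after dropping the first `n` terms. -/
def tail (n : ℕ) (c : ℕ → ℕ) : ℕ → ℕ := fun i => c (n + i)

/-- The reflection `m - c_i`, where `m = ⌈q⌉ - 1` is the largest integer smaller than `q`.
It is applied only to sequences of digits `c_i ≤ m`. -/
noncomputable def reflection (q : ℝ) (c : ℕ → ℕ) : ℕ → ℕ := fun i => (⌈q⌉₊ - 1) - c i

/-- The set `𝒱_q`; sequences are compared lexicographically. -/
def vSet (q : ℝ) : Set ℝ :=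
  {x | x ∈ interval q ∧ ∀ n, 0 < quasiGreedy q x n →
    toLex (reflection q (tail (n + 1) (quasiGreedy q x))) ≤ toLex (alpha q)}

/-- The set `𝒱_q'` of the quasi-greedy expansions of the elements of `𝒱_q`. -/
def vSeqs (q : ℝ) : Set (ℕ → ℕ) := quasiGreedy q '' vSet q

/-- The set `𝒢_q'`, the intersection of all `𝒰_r'` with `r > q` and `⌈r⌉ = ⌈q⌉`. -/
def gSeqs (q : ℝ) : Set (ℕ → ℕ) :=
  ⋂ r ∈ {r : ℝ | q < r ∧ ⌈r⌉ = ⌈q⌉}, univoqueSeqs r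

end UniqueExpansions

namespace UniqueExpansions

/-! Let `m < q < m + 1`. Since every number in `[0, m / (q - 1)]` has an expansion, a digit below
`m` can be raised exactly when the tail after it has value at least `1`, and a positive digit
lowered exactly when the reflected tail does. So univoque sequences are those with all these values
`< 1` (`univoqueSeqs_eq`). Values drop strictly as the base grows, and the partial sums are
continuous in it, so intersecting over `r > q` relaxes `< 1` to `≤ 1` in base `q` (`gSeqs_eq`).
These weak sequences are quasi-greedy, and the lexicographic bound by `alpha q` amounts to the same
value bound (`vSeqs_eq`). A weak sequence that is not strict has a tail, or a reflected tail, of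
value exactly `1`. That tail is again weak, hence quasi-greedy, hence equal to `alpha q`. So the
difference consists of sequences ending in `alpha q` or its reflection, a countable set
(`countable_weakSeqs_diff`). One non-integer univoque base then refutes the equivalence. -/

/-- The number `∑ c_i / q ^ i` represented by the sequence `c` in base `q`. -/
noncomputable def value (q : ℝ) (c : ℕ → ℕ) : ℝ := ∑' i, (c i : ℝ) / q ^ (i + 1)

/-- The reflection of a sequence of digits `c i ≤ m`. -/
def reflect (m : ℕ) (c : ℕ → ℕ) : ℕ → ℕ := fun i => m - c i

theorem reflect_le (m : ℕ) (c : ℕ → ℕ) (i : ℕ) : reflect m c i ≤ m := Nat.sub_le _ _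

theorem reflect_reflect {m : ℕ} {c : ℕ → ℕ} (hc : ∀ i, c i ≤ m) :
    reflect m (reflect m c) = c := by
  funext i
  have := hc i
  simp only [reflect]
  omega

theorem tail_zero (c : ℕ → ℕ) : tail 0 c = c := by
  funext i
  simp [tail]

theorem tail_tail (k n : ℕ) (c : ℕ → ℕ) : tail k (tail n c) = tail (n + k) c := by
  funext i
  simp [tail, add_assoc]

theorem reflect_tail (m n : ℕ) (c : ℕ → ℕ) : reflect m (tail n c) = tail n (reflect m c) := rfl

/-! ### Values of digit sequences and their dependence on the base -/

section Value

variable {q : ℝ} {m : ℕ} {c : ℕ → ℕ}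

theorem hasSum_const_digit (hq : 1 < q) (m : ℕ) :
    HasSum (fun i : ℕ => (m : ℝ) / q ^ (i + 1)) (m / (q - 1)) := by
  have hq0 : 0 < q := zero_lt_one.trans hq
  have h := (hasSum_geometric_of_lt_one (inv_nonneg.2 hq0.le) (inv_lt_one_of_one_lt₀ hq)).mul_left
    ((m : ℝ) / q)
  have hq1 : q - 1 ≠ 0 := by linarith
  have e : (m : ℝ) / q * (1 - q⁻¹)⁻¹ = m / (q - 1) := by
    rw [← div_eq_mul_inv, div_div, mul_sub, mul_inv_cancel₀ hq0.ne', mul_one]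
  rw [e] at h
  refine h.congr_fun fun i => ?_
  rw [inv_pow, pow_succ']
  field_simp

theorem summable_digits (hq : 1 < q) (hc : ∀ i, c i ≤ m) :
    Summable (fun i => (c i : ℝ) / q ^ (i + 1)) := by
  have hq0 : 0 < q := zero_lt_one.trans hq
  refine Summable.of_nonneg_of_le (fun i => by positivity) (fun i => ?_)
    (hasSum_const_digit hq m).summable
  have : (c i : ℝ) ≤ m := by exact_mod_cast hc i
  gcongr

theorem value_nonneg (hq : 1 < q) (c : ℕ → ℕ) : 0 ≤ value q c := by
  have hq0 : 0 < q := zero_lt_one.trans hq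
  exact tsum_nonneg fun i => by positivity

theorem value_le (hq : 1 < q) (hc : ∀ i, c i ≤ m) : value q c ≤ m / (q - 1) := by
  have hq0 : 0 < q := zero_lt_one.trans hq
  rw [← (hasSum_const_digit hq m).tsum_eq]
  refine (summable_digits hq hc).tsum_le_tsum (fun i => ?_) (hasSum_const_digit hq m).summable
  have : (c i : ℝ) ≤ m := by exact_mod_cast hc i
  gcongr

theorem value_reflect (hq : 1 < q) (hc : ∀ i, c i ≤ m) :
    value q (reflect m c) = m / (q - 1) - value q c := by
  refine (((hasSum_const_digit hq m).sub (summable_digits hq hc).hasSum).congr_fun ?_).tsum_eq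
  intro i
  simp only [reflect]
  rw [Nat.cast_sub (hc i), sub_div]

theorem value_eq_sum_add (hq : 1 < q) (hc : ∀ i, c i ≤ m) (n : ℕ) :
    value q c = ∑ i ∈ Finset.range n, (c i : ℝ) / q ^ (i + 1) + value q (tail n c) / q ^ n := by
  have hq0 : 0 < q := zero_lt_one.trans hq
  rw [value, ← (summable_digits hq hc).sum_add_tsum_nat_add n, value, ← tsum_div_const]
  congr 2
  funext i
  simp only [tail]
  rw [add_comm i n, div_div, ← pow_add]
  congr 2
  ring

theorem value_tail (hq : 1 < q) (hc : ∀ i, c i ≤ m) (n : ℕ) :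
    value q (tail n c) = (c n + value q (tail (n + 1) c)) / q := by
  have h := value_eq_sum_add (c := tail n c) hq (fun i => hc _) 1
  rw [tail_tail] at h
  rw [h]
  simp [tail, add_div]

theorem sum_le_value (hq : 1 < q) (hc : ∀ i, c i ≤ m) (n : ℕ) :
    ∑ i ∈ Finset.range n, (c i : ℝ) / q ^ (i + 1) ≤ value q c := by
  have hq0 : 0 < q := zero_lt_one.trans hq
  exact (summable_digits hq hc).sum_le_tsum _ fun i _ => by positivity

theorem value_pos (hq : 1 < q) (hc : ∀ i, c i ≤ m) {i : ℕ} (hi : 0 < c i) : 0 < value q c := by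
  have hq0 : 0 < q := zero_lt_one.trans hq
  have : (0 : ℝ) < c i := by exact_mod_cast hi
  exact (summable_digits hq hc).tsum_pos (fun i => by positivity) i (by positivity)

theorem value_le_mul_value {r : ℝ} (hq : 1 < q) (hqr : q ≤ r) (hc : ∀ i, c i ≤ m) :
    value r c ≤ q / r * value q c := by
  have hq0 : 0 < q := zero_lt_one.trans hq
  have hr0 : 0 < r := hq0.trans_le hqr
  rw [value, value, ← tsum_mul_left]
  refine (summable_digits (hq.trans_le hqr) hc).tsum_le_tsum (fun i => ?_)
    ((summable_digits hq hc).mul_left _)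
  have e : q / r * ((c i : ℝ) / q ^ (i + 1)) = c i / (r * q ^ i) := by
    rw [pow_succ]
    field_simp
  rw [e, pow_succ' r]
  gcongr

/-- Letting `r` decrease to `q` in each finite partial sum first, and only then `n → ∞`, avoids
continuity of the whole series in the base. -/
theorem value_le_one_of_forall_gt {b : ℝ} (hq : 1 < q) (hqb : q < b) (hc : ∀ i, c i ≤ m)
    (h : ∀ r, q < r → r ≤ b → value r c < 1) : value q c ≤ 1 := by
  have hq0 : 0 < q := zero_lt_one.trans hq
  refine le_of_tendsto (summable_digits hq hc).hasSum.tendsto_sum_nat (.of_forall fun n => ?_)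
  have hcont : ContinuousAt
      (fun r : ℝ => ∑ i ∈ Finset.range n, (c i : ℝ) / r ^ (i + 1)) q := by
    refine tendsto_finsetSum _ fun i _ => ?_
    exact ContinuousAt.div continuousAt_const (continuousAt_id.pow _) (pow_ne_zero _ hq0.ne')
  refine le_of_tendsto (hcont.tendsto.mono_left (nhdsWithin_le_nhds (s := Set.Ioi q))) ?_
  filter_upwards [Ioc_mem_nhdsGT hqb] with r hr
  exact (sum_le_value (hq.trans hr.1) hc n).trans (h r hr.1 hr.2).le

end Value

/-! ### Quasi-greedy expansions -/

section QuasiGreedy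

variable {q x : ℝ} {m : ℕ}

theorem quasiGreedy_le (hq : 1 < q) (hqm : q ≤ m + 1) (hx : 0 ≤ x) (n : ℕ) :
    quasiGreedy q x n ≤ m := by
  rcases hx.eq_or_lt with rfl | hx
  · simp [quasiGreedy_zero hq]
  · have h := (quasiGreedy_isGreatest hq hx n).1.1.trans_le hqm
    have : quasiGreedy q x n < m + 1 := by exact_mod_cast h
    omega

theorem sum_quasiGreedy_lt (hq : 1 < q) (hx : 0 < x) (n : ℕ) :
    ∑ i ∈ Finset.range n, (quasiGreedy q x i : ℝ) / q ^ (i + 1) < x := by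
  cases n with
  | zero => simpa using hx
  | succ k =>
    rw [Finset.sum_range_succ]
    exact (quasiGreedy_isGreatest hq hx k).1.2

theorem le_sum_quasiGreedy_add (hq : 1 < q) (hmq : m < q) (hx : 0 < x) {n : ℕ}
    (h : quasiGreedy q x n < m) :
    x ≤ ∑ i ∈ Finset.range (n + 1), (quasiGreedy q x i : ℝ) / q ^ (i + 1) + 1 / q ^ (n + 1) := by
  by_contra! hlt
  have hd : ((quasiGreedy q x n + 1 : ℕ) : ℝ) < q := by
    refine lt_of_le_of_lt ?_ hmq
    exact_mod_cast h
  have hle : quasiGreedy q x n + 1 ≤ quasiGreedy q x n := by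
    refine (quasiGreedy_isGreatest hq hx n).2 ⟨hd, ?_⟩
    rw [Finset.sum_range_succ] at hlt
    push_cast
    rw [add_div]
    linarith
  omega

theorem le_sum_quasiGreedy_add_max (hq : 1 < q) (hmq : m < q) (hqm : q ≤ m + 1) (hx : 0 < x)
    (hxm : x ≤ m / (q - 1)) (n : ℕ) :
    x ≤ ∑ i ∈ Finset.range n, (quasiGreedy q x i : ℝ) / q ^ (i + 1) + m / (q - 1) / q ^ n := by
  have hq0 : 0 < q := zero_lt_one.trans hq
  have hq1 : 0 < q - 1 := sub_pos.2 hq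
  induction n with
  | zero => simpa using hxm
  | succ n ih =>
    rcases (quasiGreedy_le hq hqm hx.le n).lt_or_eq with h | h
    · refine (le_sum_quasiGreedy_add hq hmq hx h).trans ?_
      -- A non-maximal digit leaves a remainder of at most one unit, which the largest possible tail
      -- covers because `q ≤ m + 1`.
      have : 1 ≤ m / (q - 1) := by
        rw [le_div_iff₀ hq1]
        linarith
      gcongr
    · rw [Finset.sum_range_succ, h, add_assoc]
      convert ih using 2
      rw [pow_succ]
      field_simp
      ring

theorem hasSum_quasiGreedy (hq : 1 < q) (hmq : m < q) (hqm : q ≤ m + 1) (hx : 0 ≤ x)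
    (hxm : x ≤ m / (q - 1)) : HasSum (fun i => (quasiGreedy q x i : ℝ) / q ^ (i + 1)) x := by
  have hq0 : 0 < q := zero_lt_one.trans hq
  rcases hx.eq_or_lt with rfl | hx
  · simp [quasiGreedy_zero hq, hasSum_zero]
  · rw [hasSum_iff_tendsto_nat_of_nonneg (fun i => by positivity)]
    have hlim : Filter.Tendsto (fun n : ℕ => x - m / (q - 1) / q ^ n) Filter.atTop (nhds x) := by
      simpa using (tendsto_const_nhds (x := x)).sub
        ((tendsto_const_nhds (x := (m : ℝ) / (q - 1))).div_atTop
          (tendsto_pow_atTop_atTop_of_one_lt hq))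
    refine tendsto_of_tendsto_of_tendsto_of_le_of_le hlim tendsto_const_nhds (fun n => ?_)
      (fun n => (sum_quasiGreedy_lt hq hx n).le)
    have := le_sum_quasiGreedy_add_max hq hmq hqm hx hxm n
    simp only
    linarith

theorem value_quasiGreedy (hq : 1 < q) (hmq : m < q) (hqm : q ≤ m + 1) (hx : 0 ≤ x)
    (hxm : x ≤ m / (q - 1)) : value q (quasiGreedy q x) = x :=
  (hasSum_quasiGreedy hq hmq hqm hx hxm).tsum_eq

theorem exists_value_eq (hq : 1 < q) (hmq : m < q) (hqm : q ≤ m + 1) (hx : 0 ≤ x)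
    (hxm : x ≤ m / (q - 1)) : ∃ c : ℕ → ℕ, (∀ i, c i ≤ m) ∧ value q c = x :=
  ⟨quasiGreedy q x, quasiGreedy_le hq hqm hx, value_quasiGreedy hq hmq hqm hx hxm⟩

theorem value_tail_quasiGreedy_le_one (hq : 1 < q) (hmq : m < q) (hqm : q ≤ m + 1) (hx : 0 ≤ x)
    (hxm : x ≤ m / (q - 1)) {n : ℕ} (h : quasiGreedy q x n < m) :
    value q (tail (n + 1) (quasiGreedy q x)) ≤ 1 := by
  have hq0 : 0 < q := zero_lt_one.trans hq
  rcases hx.eq_or_lt with rfl | hx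
  · simp [value, tail, quasiGreedy_zero hq]
  · have h1 := le_sum_quasiGreedy_add hq hmq hx h
    have h2 := value_eq_sum_add hq (quasiGreedy_le hq hqm hx.le) (n + 1)
    rw [value_quasiGreedy hq hmq hqm hx.le hxm] at h2
    have h3 : value q (tail (n + 1) (quasiGreedy q x)) / q ^ (n + 1) ≤ 1 / q ^ (n + 1) := by
      linarith
    rwa [div_le_div_iff_of_pos_right (by positivity)] at h3

theorem toLex_quasiGreedy_mono {y : ℝ} (hq : 1 < q) (hx : 0 < x) (hxy : x ≤ y) :
    toLex (quasiGreedy q x) ≤ toLex (quasiGreedy q y) := by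
  by_contra! hlt
  obtain ⟨n, heq, hn⟩ := hlt
  change ∀ i < n, quasiGreedy q y i = quasiGreedy q x i at heq
  change quasiGreedy q y n < quasiGreedy q x n at hn
  have hs : ∑ i ∈ Finset.range n, (quasiGreedy q y i : ℝ) / q ^ (i + 1) =
      ∑ i ∈ Finset.range n, (quasiGreedy q x i : ℝ) / q ^ (i + 1) :=
    Finset.sum_congr rfl fun i hi => by rw [heq i (Finset.mem_range.1 hi)]
  have hg := (quasiGreedy_isGreatest hq hx n).1
  have hle : quasiGreedy q x n ≤ quasiGreedy q y n :=
    (quasiGreedy_isGreatest hq (hx.trans_le hxy) n).2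
      ⟨hg.1, by rw [hs]; exact hg.2.trans_le hxy⟩
  omega

/-- A sequence with infinitely many nonzero digits none of whose digits can be increased is
quasi-greedy. -/
theorem eq_quasiGreedy {c : ℕ → ℕ} (hq : 1 < q) (hmq : m < q) (hqm : q ≤ m + 1)
    (hc : ∀ i, c i ≤ m) (hx : 0 < value q c) (hpos : ∀ n, 0 < value q (tail n c))
    (hle : ∀ n, c n < m → value q (tail (n + 1) c) ≤ 1) : c = quasiGreedy q (value q c) := by
  have hq0 : 0 < q := zero_lt_one.trans hq
  funext n
  induction n using Nat.strong_induction_on with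
  | _ n ih =>
    have hs : ∑ i ∈ Finset.range n, (quasiGreedy q (value q c) i : ℝ) / q ^ (i + 1) =
        ∑ i ∈ Finset.range n, (c i : ℝ) / q ^ (i + 1) :=
      Finset.sum_congr rfl fun i hi => by rw [← ih i (Finset.mem_range.1 hi)]
    have hg := quasiGreedy_isGreatest hq hx n
    have hv := value_eq_sum_add hq hc (n + 1)
    rw [Finset.sum_range_succ] at hv
    rw [hs] at hg
    have hqn : 0 < q ^ (n + 1) := by positivity
    refine le_antisymm (hg.2 ⟨lt_of_le_of_lt (by exact_mod_cast hc n) hmq, ?_⟩) ?_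
    · have := div_pos (hpos (n + 1)) hqn
      linarith
    · by_contra! hlt
      have h1 := hle n (hlt.trans_le (quasiGreedy_le hq hqm hx.le n))
      have h2 : value q (tail (n + 1) c) / q ^ (n + 1) ≤ 1 / q ^ (n + 1) := by gcongr
      have h3 : ((c n : ℝ) + 1) / q ^ (n + 1) ≤
          (quasiGreedy q (value q c) n : ℝ) / q ^ (n + 1) := by
        gcongr
        exact_mod_cast hlt
      rw [add_div] at h3
      linarith [hg.1.2]

end QuasiGreedy

/-! ### Univoque sequences, their weak variant and the lexicographic condition -/

section Univoque

variable {q : ℝ} {m : ℕ} {c : ℕ → ℕ}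

/-- Sequences of digits `≤ m` for which neither increasing nor decreasing one digit leaves a
remainder that is the value of a sequence of digits. -/
def strictSeqs (q : ℝ) (m : ℕ) : Set (ℕ → ℕ) :=
  {c | (∀ i, c i ≤ m) ∧ ∀ n, (c n < m → value q (tail (n + 1) c) < 1) ∧
    (0 < c n → value q (reflect m (tail (n + 1) c)) < 1)}

/-- The variant of `strictSeqs` with non-strict inequalities. -/
def weakSeqs (q : ℝ) (m : ℕ) : Set (ℕ → ℕ) :=
  {c | (∀ i, c i ≤ m) ∧ ∀ n, (c n < m → value q (tail (n + 1) c) ≤ 1) ∧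
    (0 < c n → value q (reflect m (tail (n + 1) c)) ≤ 1)}

theorem isExpansion_iff {x : ℝ} (hq : 1 < q) (hmq : m < q) (hqm : q ≤ m + 1) :
    IsExpansion q x c ↔ (∀ i, c i ≤ m) ∧ value q c = x := by
  have hd : (∀ i, (c i : ℝ) < q) ↔ ∀ i, c i ≤ m := by
    refine forall_congr' fun i => ⟨fun h => ?_, fun h => ?_⟩
    · have : c i < m + 1 := by exact_mod_cast h.trans_le hqm
      omega
    · exact lt_of_le_of_lt (by exact_mod_cast h) hmq
  rw [IsExpansion, hd]
  refine and_congr_right fun h => ⟨fun h' => h'.tsum_eq, fun h' => ?_⟩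
  rw [← h']
  exact (summable_digits hq h).hasSum

/-- At a first differing digit the tail of `d` would have to exceed `m / (q - 1)` or be negative. -/
theorem eq_of_value_eq {d : ℕ → ℕ} (hq : 1 < q) (hc : c ∈ strictSeqs q m) (hd : ∀ i, d i ≤ m)
    (h : value q d = value q c) : d = c := by
  have hq0 : 0 < q := zero_lt_one.trans hq
  have key : ∀ n, d n = c n ∧ value q (tail (n + 1) d) = value q (tail (n + 1) c) := by
    have step : ∀ n, value q (tail n d) = value q (tail n c) →
        d n = c n ∧ value q (tail (n + 1) d) = value q (tail (n + 1) c) := by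
      intro n hn
      rw [value_tail hq hd, value_tail hq hc.1, div_left_inj' hq0.ne'] at hn
      have hdc : d n = c n := by
        rcases lt_trichotomy (d n) (c n) with hlt | heq | hlt
        · have h1 := (hc.2 n).2 (by omega)
          rw [value_reflect (c := tail (n + 1) c) hq fun i => hc.1 _] at h1
          have h2 := value_le (c := tail (n + 1) d) hq fun i => hd _
          have h3 : (d n : ℝ) + 1 ≤ c n := by exact_mod_cast hlt
          linarith
        · exact heq
        · have h1 := (hc.2 n).1 (hlt.trans_le (hd n))
          have h2 := value_nonneg hq (tail (n + 1) d)
          have h3 : (c n : ℝ) + 1 ≤ d n := by exact_mod_cast hlt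
          linarith
      rw [hdc] at hn
      exact ⟨hdc, by linarith⟩
    intro n
    induction n with
    | zero => exact step 0 (by simpa only [tail_zero] using h)
    | succ n ih => exact step (n + 1) ih.2
  exact funext fun n => (key n).1

/-- Keep the first `n` digits, put `k` next, and expand the remainder `x` afresh. This produces the
second expansion when a strict inequality fails. -/
theorem exists_value_eq_update {x : ℝ} (hq : 1 < q) (hmq : m < q) (hqm : q ≤ m + 1)
    (hc : ∀ i, c i ≤ m) {n k : ℕ} (hk : k ≤ m) (hx : 0 ≤ x) (hxm : x ≤ m / (q - 1))
    (h : (k : ℝ) + x = c n + value q (tail (n + 1) c)) :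
    ∃ d : ℕ → ℕ, (∀ i, d i ≤ m) ∧ value q d = value q c ∧ d n = k := by
  have hq0 : 0 < q := zero_lt_one.trans hq
  obtain ⟨e, he, hex⟩ := exists_value_eq hq hmq hqm hx hxm
  let d : ℕ → ℕ := fun i => if i < n then c i else if i = n then k else e (i - (n + 1))
  have hd : ∀ i, d i ≤ m := by
    intro i
    simp only [d]
    split_ifs
    exacts [hc i, hk, he _]
  have hdn : d n = k := by simp [d]
  have ht : tail (n + 1) d = e := by
    funext i
    have h1 : ¬ n + 1 + i < n := by omega
    have h2 : ¬ n + 1 + i = n := by omega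
    simp [tail, d, h1, h2]
  refine ⟨d, hd, ?_, hdn⟩
  rw [value_eq_sum_add hq hd n, value_eq_sum_add hq hc n, value_tail hq hd, value_tail hq hc, hdn,
    ht, hex, h]
  congr 1
  refine Finset.sum_congr rfl fun i hi => ?_
  simp [d, Finset.mem_range.1 hi]

theorem univoqueSeqs_eq (hq : 1 < q) (hmq : m < q) (hqm : q ≤ m + 1) :
    univoqueSeqs q = strictSeqs q m := by
  have hceil : (⌈q⌉ : ℝ) - 1 = m := by
    have : ⌈q⌉ = (m : ℤ) + 1 := by
      rw [Int.ceil_eq_iff]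
      push_cast
      exact ⟨by linarith, hqm⟩
    rw [this]
    push_cast
    ring
  ext c
  constructor
  · rintro ⟨x, ⟨-, c', -, huniq⟩, hcx⟩
    obtain ⟨hc, rfl⟩ := (isExpansion_iff hq hmq hqm).1 hcx
    have huniq' : ∀ d : ℕ → ℕ, (∀ i, d i ≤ m) → value q d = value q c → d = c := fun d hd h =>
      (huniq d ((isExpansion_iff hq hmq hqm).2 ⟨hd, h⟩)).trans (huniq c hcx).symm
    refine ⟨hc, fun n => ⟨fun hn => ?_, fun hn => ?_⟩⟩
    · by_contra! hge
      have hle := value_le (c := tail (n + 1) c) hq fun i => hc _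
      obtain ⟨d, hd, hdv, hdn⟩ := exists_value_eq_update hq hmq hqm hc (n := n) (k := c n + 1)
        (x := value q (tail (n + 1) c) - 1) hn (by linarith) (by linarith) (by push_cast; ring)
      rw [huniq' d hd hdv] at hdn
      omega
    · by_contra! hge
      rw [value_reflect (c := tail (n + 1) c) hq fun i => hc _] at hge
      have hle := value_nonneg hq (tail (n + 1) c)
      obtain ⟨d, hd, hdv, hdn⟩ := exists_value_eq_update hq hmq hqm hc (n := n) (k := c n - 1)
        (x := value q (tail (n + 1) c) + 1) ((Nat.sub_le _ _).trans (hc n)) (by linarith)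
        (by linarith) (by rw [Nat.cast_sub hn]; push_cast; ring)
      rw [huniq' d hd hdv] at hdn
      omega
  · intro hc
    have hcx : IsExpansion q (value q c) c := (isExpansion_iff hq hmq hqm).2 ⟨hc.1, rfl⟩
    refine ⟨value q c, ⟨⟨value_nonneg hq c, ?_⟩, c, hcx, fun d hd => ?_⟩, hcx⟩
    · rw [hceil]
      exact value_le hq hc.1
    · obtain ⟨hd, hv⟩ := (isExpansion_iff hq hmq hqm).1 hd
      exact eq_of_value_eq hq hc hd hv

theorem gSeqs_eq (hq : 1 < q) (hmq : m < q) (hqm : q < m + 1) : gSeqs q = weakSeqs q m := by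
  have hceil : ∀ r : ℝ, ⌈r⌉ = ⌈q⌉ ↔ m < r ∧ r ≤ m + 1 := by
    intro r
    have : ⌈q⌉ = (m : ℤ) + 1 := by
      rw [Int.ceil_eq_iff]
      push_cast
      exact ⟨by linarith, hqm.le⟩
    rw [this, Int.ceil_eq_iff]
    push_cast
    simp
  ext c
  simp only [gSeqs, Set.mem_iInter, Set.mem_ofPred_eq, hceil]
  constructor
  · intro h
    have h' : ∀ r, q < r → r ≤ m + 1 → c ∈ strictSeqs r m := by
      intro r hr hrm
      rw [← univoqueSeqs_eq (hq.trans hr) (hmq.trans hr) hrm]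
      exact h r ⟨hr, hmq.trans hr, hrm⟩
    -- The base `m + 1` still has the same ceiling, so the intersection is not vacuous and bounds
    -- the digits.
    have hc := (h' (m + 1) hqm le_rfl).1
    refine ⟨hc, fun n => ⟨fun hn => ?_, fun hn => ?_⟩⟩
    · exact value_le_one_of_forall_gt (m := m) hq hqm (fun i => hc _)
        fun r hr hrm => ((h' r hr hrm).2 n).1 hn
    · exact value_le_one_of_forall_gt hq hqm (reflect_le m _)
        fun r hr hrm => ((h' r hr hrm).2 n).2 hn
  · rintro hc r ⟨hr, hmr, hrm⟩
    rw [univoqueSeqs_eq (hq.trans hr) hmr hrm]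
    have key : ∀ d : ℕ → ℕ, (∀ i, d i ≤ m) → value q d ≤ 1 → value r d < 1 := by
      intro d hd h
      have hr0 : 0 < r := by linarith
      have hqr : q / r < 1 := by rwa [div_lt_one hr0]
      have h0 : 0 ≤ q / r := div_nonneg (by linarith) hr0.le
      exact (value_le_mul_value hq hr.le hd).trans_lt
        ((mul_le_of_le_one_right h0 h).trans_lt hqr)
    exact ⟨hc.1, fun n => ⟨fun hn => key _ (fun i => hc.1 _) ((hc.2 n).1 hn),
      fun hn => key _ (reflect_le m _) ((hc.2 n).2 hn)⟩⟩

theorem tail_mem_weakSeqs (hc : c ∈ weakSeqs q m) (n : ℕ) : tail n c ∈ weakSeqs q m := by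
  refine ⟨fun i => hc.1 _, fun k => ?_⟩
  rw [tail_tail]
  exact hc.2 (n + k)

theorem reflect_mem_weakSeqs (hc : c ∈ weakSeqs q m) : reflect m c ∈ weakSeqs q m := by
  refine ⟨reflect_le m c, fun n => ?_⟩
  rw [← reflect_tail, reflect_reflect (c := tail (n + 1) c) fun i => hc.1 _]
  have h := hc.2 n
  have := hc.1 n
  simp only [reflect] at h ⊢
  exact ⟨fun hn => h.2 (by omega), fun hn => h.1 (by omega)⟩

/-- Zeros forever after a positive digit would give a reflected tail of value `m / (q - 1) > 1`;
this needs `q < m + 1` strictly. -/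
theorem value_tail_pos (hq : 1 < q) (hqm : q < m + 1) (hc : c ∈ weakSeqs q m)
    (hx : 0 < value q c) (n : ℕ) : 0 < value q (tail n c) := by
  have hq0 : 0 < q := zero_lt_one.trans hq
  have hq1 : 0 < q - 1 := sub_pos.2 hq
  induction n with
  | zero => simpa only [tail_zero] using hx
  | succ n ih =>
    rw [value_tail hq hc.1] at ih
    have ih' : 0 < (c n : ℝ) + value q (tail (n + 1) c) := (div_pos_iff_of_pos_right hq0).1 ih
    rcases (c n).eq_zero_or_pos with h | h
    · simpa [h] using ih'
    · have h1 := (hc.2 n).2 h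
      rw [value_reflect (c := tail (n + 1) c) hq fun i => hc.1 _] at h1
      have h2 : 1 < m / (q - 1) := by
        rw [lt_div_iff₀ hq1]
        linarith
      linarith

theorem eq_quasiGreedy_of_mem_weakSeqs (hq : 1 < q) (hmq : m < q) (hqm : q < m + 1)
    (hc : c ∈ weakSeqs q m) : c = quasiGreedy q (value q c) := by
  rcases (value_nonneg hq c).eq_or_lt with h | h
  · funext i
    rw [← h, quasiGreedy_zero hq]
    by_contra hi
    exact (value_pos hq hc.1 (Nat.pos_of_ne_zero hi)).ne h
  · exact eq_quasiGreedy hq hmq hqm.le hc.1 h (value_tail_pos hq hqm hc h) fun n => (hc.2 n).1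

theorem toLex_le_alpha (hq : 1 < q) (hmq : m < q) (hqm : q < m + 1)
    (hc : c ∈ weakSeqs q m) (h : value q c ≤ 1) : toLex c ≤ toLex (alpha q) := by
  rw [eq_quasiGreedy_of_mem_weakSeqs hq hmq hqm hc]
  rcases (value_nonneg hq c).eq_or_lt with h0 | h0
  · rw [← h0]
    exact Pi.toLex_monotone fun i => by simp [quasiGreedy_zero hq]
  · exact toLex_quasiGreedy_mono hq h0 h

/-- Where a tail first falls below `alpha q`, raising that digit by one keeps the partial sum below
`1`. So the excess over `1` is at most a later excess divided by `q ^ (j + 1)`; each of the `k`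
rounds gains at least a factor `q`, and `k → ∞` leaves no excess. -/
theorem value_tail_sub_one_le (hq : 1 < q) (hmq : m < q) (hqm : q ≤ m + 1) (hc : ∀ i, c i ≤ m)
    (h : ∀ n, c n < m → toLex (tail (n + 1) c) ≤ toLex (alpha q)) (k : ℕ) :
    ∀ n, c n < m → value q (tail (n + 1) c) - 1 ≤ m / (q - 1) / q ^ k := by
  have hq0 : 0 < q := zero_lt_one.trans hq
  have hq1 : 0 < q - 1 := sub_pos.2 hq
  have h1m : 1 ≤ m / (q - 1) := by
    rw [le_div_iff₀ hq1]
    linarith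
  induction k with
  | zero =>
    intro n _
    have := value_le (c := tail (n + 1) c) hq fun i => hc _
    simp only [pow_zero, div_one]
    linarith
  | succ k ih =>
    intro n hn
    rcases (h n hn).eq_or_lt with heq | ⟨j, hj, hlt⟩
    · have : tail (n + 1) c = alpha q := heq
      rw [this, alpha, value_quasiGreedy hq hmq hqm zero_le_one h1m]
      simp only [sub_self]
      positivity
    · change ∀ i < j, tail (n + 1) c i = alpha q i at hj
      change c (n + 1 + j) < alpha q j at hlt
      have h1 := ih (n + 1 + j) (hlt.trans_le (quasiGreedy_le hq hqm zero_le_one j))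
      have h2 := value_eq_sum_add (c := tail (n + 1) c) hq (fun i => hc _) (j + 1)
      have h3 := (quasiGreedy_isGreatest hq zero_lt_one j).1.2
      have hs : ∑ i ∈ Finset.range j, (tail (n + 1) c i : ℝ) / q ^ (i + 1) =
          ∑ i ∈ Finset.range j, (quasiGreedy q 1 i : ℝ) / q ^ (i + 1) :=
        Finset.sum_congr rfl fun i hi => by rw [hj i (Finset.mem_range.1 hi), alpha]
      rw [tail_tail, Finset.sum_range_succ, hs] at h2
      have h4 : ((c (n + 1 + j) : ℝ) + 1) / q ^ (j + 1) ≤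
          (quasiGreedy q 1 j : ℝ) / q ^ (j + 1) := by
        gcongr
        exact_mod_cast hlt
      have h5 : (tail (n + 1) c j : ℝ) = c (n + 1 + j) := rfl
      have h6 : (value q (tail (n + 1 + j + 1) c) - 1) / q ^ (j + 1) ≤
          m / (q - 1) / q ^ (k + 1) := by
        calc (value q (tail (n + 1 + j + 1) c) - 1) / q ^ (j + 1)
            ≤ m / (q - 1) / q ^ k / q ^ (j + 1) := by gcongr
          _ ≤ m / (q - 1) / q ^ k / q ^ 1 := by
            gcongr
            · exact hq.le
            · omega
          _ = m / (q - 1) / q ^ (k + 1) := by rw [pow_one, div_div, ← pow_succ]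
      rw [h5, show n + 1 + (j + 1) = n + 1 + j + 1 by ring] at h2
      rw [add_div] at h4
      rw [sub_div] at h6
      linarith

theorem value_tail_le_one (hq : 1 < q) (hmq : m < q) (hqm : q ≤ m + 1) (hc : ∀ i, c i ≤ m)
    (h : ∀ n, c n < m → toLex (tail (n + 1) c) ≤ toLex (alpha q)) {n : ℕ} (hn : c n < m) :
    value q (tail (n + 1) c) ≤ 1 := by
  have hlim : Filter.Tendsto (fun k : ℕ => (m : ℝ) / (q - 1) / q ^ k) Filter.atTop (nhds 0) :=
    tendsto_const_nhds.div_atTop (tendsto_pow_atTop_atTop_of_one_lt hq)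
  have := ge_of_tendsto hlim
    (.of_forall fun k => value_tail_sub_one_le hq hmq hqm hc h k n hn)
  linarith

theorem vSeqs_eq (hq : 1 < q) (hmq : m < q) (hqm : q < m + 1) : vSeqs q = weakSeqs q m := by
  have hceil : ⌈q⌉ = (m : ℤ) + 1 := by
    rw [Int.ceil_eq_iff]
    push_cast
    exact ⟨by linarith, hqm.le⟩
  have hceil' : ⌈q⌉₊ - 1 = m := by
    rw [← Int.ceil_toNat, hceil]
    omega
  have hint : (((⌈q⌉ : ℤ) : ℝ) - 1) / (q - 1) = m / (q - 1) := by
    rw [hceil]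
    push_cast
    rw [add_sub_cancel_right]
  have hrefl : ∀ c, reflection q c = reflect m c := fun c => by
    funext i
    rw [reflection, reflect, hceil']
  ext c
  constructor
  · rintro ⟨x, ⟨⟨hx, hxm⟩, hlex⟩, rfl⟩
    rw [hint] at hxm
    have hc := quasiGreedy_le hq hqm.le hx
    refine ⟨hc, fun n => ⟨fun hn => ?_, fun hn => ?_⟩⟩
    · exact value_tail_quasiGreedy_le_one hq hmq hqm.le hx hxm hn
    -- Raising a digit of the reflection is lowering one of the original, so the defining condition
    -- of `vSet` feeds `value_tail_le_one` for the reflected sequence.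
    · rw [reflect_tail]
      have hlt : ∀ k, reflect m (quasiGreedy q x) k < m ↔ 0 < quasiGreedy q x k := by
        intro k
        have := hc k
        simp only [reflect]
        omega
      refine value_tail_le_one hq hmq hqm.le (reflect_le m _) (fun k hk => ?_) ((hlt n).2 hn)
      rw [← reflect_tail, ← hrefl]
      exact hlex k ((hlt k).1 hk)
  · intro hc
    have he := eq_quasiGreedy_of_mem_weakSeqs hq hmq hqm hc
    refine ⟨value q c, ⟨⟨value_nonneg hq c, ?_⟩, fun n hn => ?_⟩, he.symm⟩
    · rw [hint]
      exact value_le hq hc.1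
    · rw [← he] at hn ⊢
      rw [hrefl]
      exact toLex_le_alpha hq hmq hqm (reflect_mem_weakSeqs (tail_mem_weakSeqs hc _))
        ((hc.2 n).2 hn)

/-! ### Countability of the difference -/

theorem countable_tail_eq (n : ℕ) (a : ℕ → ℕ) : {c : ℕ → ℕ | tail n c = a}.Countable := by
  refine Set.MapsTo.countable_of_injOn (f := fun c (i : Fin n) => c i) (Set.mapsTo_univ _ _) ?_
    Set.countable_univ
  intro c hc d hd h
  funext i
  rcases lt_or_ge i n with hi | hi
  · exact congrFun h ⟨i, hi⟩
  · obtain ⟨j, rfl⟩ := Nat.exists_eq_add_of_le hi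
    exact congrFun ((show tail n c = a from hc).trans (show tail n d = a from hd).symm) j

theorem countable_weakSeqs_diff (hq : 1 < q) (hmq : m < q) (hqm : q < m + 1) :
    (weakSeqs q m \ strictSeqs q m).Countable := by
  refine (Set.countable_iUnion fun n => (countable_tail_eq n (alpha q)).union
    (countable_tail_eq n (reflect m (alpha q)))).mono ?_
  rintro c ⟨hc, hns⟩
  have hex : ∃ n, ¬((c n < m → value q (tail (n + 1) c) < 1) ∧
      (0 < c n → value q (reflect m (tail (n + 1) c)) < 1)) := by
    by_contra! h
    exact hns ⟨hc.1, h⟩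
  obtain ⟨n, hn⟩ := hex
  refine Set.mem_iUnion.2 ⟨n + 1, ?_⟩
  have ht := tail_mem_weakSeqs hc (n + 1)
  by_cases h : c n < m → value q (tail (n + 1) c) < 1
  · right
    have h2 : ¬(0 < c n → value q (reflect m (tail (n + 1) c)) < 1) := fun h' => hn ⟨h, h'⟩
    push Not at h2
    have hv := ((hc.2 n).2 h2.1).antisymm h2.2
    have he := eq_quasiGreedy_of_mem_weakSeqs hq hmq hqm (reflect_mem_weakSeqs ht)
    rw [hv] at he
    change tail (n + 1) c = reflect m (quasiGreedy q 1)
    rw [← he, reflect_reflect ht.1]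
  · left
    push Not at h
    have hv := ((hc.2 n).1 h.1).antisymm h.2
    have he := eq_quasiGreedy_of_mem_weakSeqs hq hmq hqm ht
    rwa [hv] at he

end Univoque

/-! ### A non-integer univoque base, and the conclusion -/

/-- The number `(3 + √5) / 2`, in whose base `1` has the unique expansion `2 1 1 1 ...`, is a
non-integer univoque number. -/
theorem exists_mem_univoqueNumbers :
    ∃ q : ℝ, 1 < q ∧ q ∉ Set.range (fun k : ℤ => (k : ℝ)) ∧ q ∈ univoqueNumbers := by
  -- The equation is `1 = (2 + 1 / (q - 1)) / q` with denominators cleared.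
  obtain ⟨q, hq2, hq3, hroot⟩ : ∃ q : ℝ, 2 < q ∧ q < 3 ∧ q * (q - 1) = 2 * q - 1 := by
    have h5 : √(5 : ℝ) * √5 = 5 := Real.mul_self_sqrt (by norm_num)
    have h0 : 0 ≤ √(5 : ℝ) := Real.sqrt_nonneg 5
    exact ⟨(3 + √5) / 2, by nlinarith, by nlinarith, by nlinarith⟩
  have hq : 1 < q := by linarith
  have hmq : ((2 : ℕ) : ℝ) < q := by exact_mod_cast hq2
  have hqm : q ≤ (2 : ℕ) + 1 := by push_cast; linarith
  let c : ℕ → ℕ := fun i => if i = 0 then 2 else 1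
  have hc : ∀ i, c i ≤ 2 := fun i => by simp only [c]; split_ifs <;> omega
  have ht : ∀ n, tail (n + 1) c = fun _ => 1 := fun n => by
    funext i
    simp [tail, c]
  have hr : reflect 2 (fun _ => 1) = fun _ => 1 := rfl
  have h1 : value q (fun _ => 1) = 1 / (q - 1) := by
    simpa [value] using (hasSum_const_digit hq 1).tsum_eq
  have hlt : 1 / (q - 1) < 1 := by
    rw [div_lt_one (by linarith)]
    linarith
  have hs : c ∈ strictSeqs q 2 := by
    refine ⟨hc, fun n => ?_⟩
    rw [ht, hr, h1]
    exact ⟨fun _ => hlt, fun _ => hlt⟩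
  have hv : value q c = 1 := by
    have h := value_eq_sum_add hq hc 1
    rw [ht 0, h1] at h
    have hq0 : q ≠ 0 := by linarith
    have hq1 : q - 1 ≠ 0 := by linarith
    simp only [Finset.sum_range_one, c, if_true, zero_add, pow_one] at h
    rw [h]
    push_cast
    field_simp
    linarith
  refine ⟨q, hq, ?_, hq, c, (isExpansion_iff hq hmq hqm).2 ⟨hc, hv⟩, fun d hd => ?_⟩
  · rintro ⟨k, hk⟩
    change (k : ℝ) = q at hk
    rw [← hk] at hq2 hq3
    have hk2 : (2 : ℤ) < k := by exact_mod_cast hq2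
    have hk3 : k < (3 : ℤ) := by exact_mod_cast hq3
    omega
  · obtain ⟨hd, hdv⟩ := (isExpansion_iff hq hmq hqm).1 hd
    exact eq_of_value_eq hq hs hd (hdv.trans hv.symm)

theorem gSeqs_eq_vSeqs_and_countable {q : ℝ} (hq : 1 < q)
    (hint : q ∉ Set.range (fun k : ℤ => (k : ℝ))) :
    gSeqs q = vSeqs q ∧ (gSeqs q \ univoqueSeqs q).Countable := by
  have hq0 : 0 ≤ q := by linarith
  have hqm : q < (⌊q⌋₊ : ℝ) + 1 := Nat.lt_floor_add_one q
  have hmq : (⌊q⌋₊ : ℝ) < q := by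
    refine (Nat.floor_le hq0).lt_of_ne fun h => hint ⟨⌊q⌋₊, ?_⟩
    simpa using h
  rw [gSeqs_eq hq hmq hqm, vSeqs_eq hq hmq hqm, univoqueSeqs_eq hq hmq hqm.le]
  exact ⟨rfl, countable_weakSeqs_diff hq hmq hqm⟩

end UniqueExpansions

theorem mainTheorem4 :
    (∀ q : ℝ, 1 < q → q ∉ Set.range (fun k : ℤ => (k : ℝ)) →
      UniqueExpansions.gSeqs q = UniqueExpansions.vSeqs q ∧
      (UniqueExpansions.gSeqs q \ UniqueExpansions.univoqueSeqs q).Countable) ∧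
    ¬ (∀ q : ℝ, 1 < q → q ∉ Set.range (fun k : ℤ => (k : ℝ)) →
      (q ∈ UniqueExpansions.univoqueNumbers ↔
        ¬ (UniqueExpansions.gSeqs q \ UniqueExpansions.univoqueSeqs q).Countable)) := by
  refine ⟨fun q hq hint => UniqueExpansions.gSeqs_eq_vSeqs_and_countable hq hint, fun h => ?_⟩
  obtain ⟨q, hq, hint, hu⟩ := UniqueExpansions.exists_mem_univoqueNumbers
  exact (h q hq hint).1 hu (UniqueExpansions.gSeqs_eq_vSeqs_and_countable hq hint).2
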